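/- Let $M$ be a $2n$-dimensional $C^\infty$ manifold and let $S\in\Gamma\,\mathrm{End}(TM)$ be a tangent structure on $M$: $\operatorname{im}S=\ker S$, and around every point there are local coordinates $(x^i,y^i)_{i=1}^n$ with $S(\partial/\partial x^i)=\partial/\partial y^i$, $S(\partial/\partial y^i)=0$. Put $T\mathcal V=\operatorname{im}S$, let $N\mathcal V$ be a smooth complementary (horizontal) distribution, $TM=N\mathcal V\oplus T\mathcal V$, with projections $p_N,p_T$, and let $g$ be a (possibly indefinite) nondegenerate metric on $TM/T\mathcal V$. Let $\gamma$ be the canonical extension of $g$, i.e. the pseudo-Riemannian metric on $M$ for which $N\mathcal V\perp T\mathcal V$, $\gamma|_{N\mathcal V}=g$ and $\gamma(SX,SY)=\gamma(X,Y)$ for $X,Y\in\Gamma N\mathcal V$, and let $\nabla$ be its Levi-Civita connection. The canonical connection $D$ is the linear connection on $TM$ given by $$D_{Z_1}Z_2=p_N\nabla_{Z_1}Z_2,\quad D_{Y_1}Y_2=p_T\nabla_{Y_1}Y_2,\quad D_{Y_1}Z_2=p_N[Y_1,Z_2],\quad D_{Z_1}Y_2=p_T[Z_1,Y_2]$$ for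 $Z_1,Z_2\in\Gamma N\mathcal V$ and $Y_1,Y_2\in\Gamma T\mathcal V$. Let $R_D(X,Y)Z=D_XD_YZ-D_YD_XZ-D_{[X,Y]}Z$ be its curvature and $T_D(X,Y)=D_XY-D_YX-[X,Y]$ its torsion. Then $D$ satisfies the first Bianchi identity $$\sum_{Cycl(X,Y,Z)}R_D(X,Y)Z=\sum_{Cycl(X,Y,Z)}\bigl\{T_D(T_D(X,Y),Z)+(D_XT_D)(Y,Z)\bigr\}\qquad\forall X,Y,Z\in\Gamma TM,$$ and this identity is equivalent to the conjunction of the following three identities, for all $X,Y,Z\in\Gamma N\mathcal V$: $$\sum_{Cycl(X,Y,Z)}R_D(SX,SY)(SZ)=0,\qquad R_D(SX,Z)SY=R_D(SY,Z)SX,\qquad \sum_{Cycl(X,Y,Z)}R_D(X,Y)Z=0.$$ -/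

import Mathlib

open Bundle VectorField
open scoped Manifold ContDiff Topology

set_option linter.unusedSectionVars false

noncomputable section

/-! ### Smoothness of sections of `Hom` bundles -/

section Bundles

variable {E : Type*} [NormedAddCommGroup E] [NormedSpace ℝ E]
  {H : Type*} [TopologicalSpace H] {I : ModelWithCorners ℝ E H}
  {M : Type*} [TopologicalSpace M] [ChartedSpace H M]
  {F₁ F₂ : Type*} [NormedAddCommGroup F₁] [NormedSpace ℝ F₁] [FiniteDimensional ℝ F₁]
  [NormedAddCommGroup F₂] [NormedSpace ℝ F₂]

/-- A map into a space of linear maps on a finite-dimensional space is smooth if its values on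
every fixed vector are. -/
theorem contMDiffAt_of_forall_apply {f : M → F₁ →L[ℝ] F₂} {x₀ : M}
    (h : ∀ e, ContMDiffAt I 𝓘(ℝ, F₂) ∞ (fun x ↦ f x e) x₀) :
    ContMDiffAt I 𝓘(ℝ, F₁ →L[ℝ] F₂) ∞ f x₀ := by
  let b := Module.finBasis ℝ F₁
  have : f = fun x ↦ ∑ i, ContinuousLinearMap.smulRightL ℝ F₁ F₂
      (LinearMap.toContinuousLinearMap (b.coord i)) (f x (b i)) := by
    funext x
    ext v
    have hv : f x v = f x (∑ i, b.repr v i • b i) := by rw [b.sum_repr v]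
    rw [hv, map_sum]
    simp
  rw [this]
  refine contMDiffAt_finsetSum fun i _ ↦ ?_
  exact (ContinuousLinearMap.contMDiff _).contMDiffAt.comp x₀ (h _)

variable {V W : M → Type*} [∀ x, AddCommGroup (V x)] [∀ x, Module ℝ (V x)]
  [TopologicalSpace (TotalSpace F₁ V)] [∀ x, TopologicalSpace (V x)]
  [FiberBundle F₁ V] [VectorBundle ℝ F₁ V]
  [∀ x, AddCommGroup (W x)] [∀ x, Module ℝ (W x)]
  [TopologicalSpace (TotalSpace F₂ W)] [∀ x, TopologicalSpace (W x)]
  [FiberBundle F₂ W] [VectorBundle ℝ F₂ W]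
  [∀ x, IsTopologicalAddGroup (W x)] [∀ x, ContinuousSMul ℝ (W x)]

/-- A section of `Hom(V, W)` is smooth at `x₀` if its values on the constant sections of a local
trivialization of `V` are. -/
theorem contMDiffAt_hom_of_apply {φ : ∀ x, V x →L[ℝ] W x} {x₀ : M}
    (h : ∀ e : F₁, ContMDiffAt I (I.prod 𝓘(ℝ, F₂)) ∞
      (fun x ↦ TotalSpace.mk' F₂ x (φ x ((trivializationAt F₁ V x₀).symmL ℝ x e))) x₀) :
    ContMDiffAt I (I.prod 𝓘(ℝ, F₁ →L[ℝ] F₂)) ∞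
      (fun x ↦ TotalSpace.mk' (F₁ →L[ℝ] F₂) (E := fun x ↦ V x →L[ℝ] W x) x (φ x)) x₀ := by
  rw [contMDiffAt_hom_bundle]
  refine ⟨contMDiffAt_id, contMDiffAt_of_forall_apply fun e ↦ ?_⟩
  have := (contMDiffAt_totalSpace.1 (h e)).2
  refine this.congr_of_eventuallyEq ?_
  filter_upwards [(trivializationAt F₁ V x₀).open_baseSet.mem_nhds
    (FiberBundle.mem_baseSet_trivializationAt' x₀), (trivializationAt F₂ W x₀).open_baseSet.mem_nhds
    (FiberBundle.mem_baseSet_trivializationAt' x₀)] with x hx hx'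
  simp [ContinuousLinearMap.inCoordinates, Trivialization.coe_linearMapAt_of_mem _ hx']

theorem contMDiffAt_symmL_apply [∀ x, IsTopologicalAddGroup (V x)]
    [∀ x, ContinuousSMul ℝ (V x)] [ContMDiffVectorBundle ∞ F₁ V I] (x₀ : M) (e : F₁) :
    ContMDiffAt I (I.prod 𝓘(ℝ, F₁)) ∞
      (fun x ↦ TotalSpace.mk' F₁ x ((trivializationAt F₁ V x₀).symmL ℝ x e)) x₀ := by
  have h := (trivializationAt F₁ V x₀).contMDiffAt_symmL (IB := I) (n := ∞)
    (FiberBundle.mem_baseSet_trivializationAt' x₀)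
  refine ContMDiffAt.clm_bundle_apply (E₁ := Bundle.Trivial M F₁) (v := fun _ ↦ e) h ?_
  rw [contMDiffAt_totalSpace]
  exact ⟨contMDiffAt_id, by simpa using! contMDiffAt_const⟩

end Bundles

/-! ### Vector fields and tensor fields -/

section Tensors

variable {E : Type*} [NormedAddCommGroup E] [NormedSpace ℝ E]
  {H : Type*} [TopologicalSpace H] (I : ModelWithCorners ℝ E H)
  (M : Type*) [TopologicalSpace M] [ChartedSpace H M]

/-- Vector fields on `M`, with no regularity. -/
abbrev VField : Type _ := ∀ x : M, TangentSpace I x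

/-- Fields of endomorphisms of `TM`, with no regularity. -/
abbrev EndField : Type _ := ∀ x : M, TangentSpace I x →L[ℝ] TangentSpace I x

/-- Fields of bilinear forms on `TM`, with no regularity. -/
abbrev BilinField : Type _ := ∀ x : M, TangentSpace I x →L[ℝ] TangentSpace I x →L[ℝ] ℝ

variable {I M}

/-- `X ∈ Γ TM`. -/
def VField.Smooth [IsManifold I 1 M] (X : VField I M) : Prop :=
  ContMDiff I (I.prod 𝓘(ℝ, E)) ∞ (fun x ↦ TotalSpace.mk' E (E := TangentSpace I) x (X x))

/-- `A ∈ Γ End(TM)`. -/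
def EndField.Smooth [IsManifold I 1 M] (A : EndField I M) : Prop :=
  ContMDiff I (I.prod 𝓘(ℝ, E →L[ℝ] E)) ∞ (fun x ↦ TotalSpace.mk' (E →L[ℝ] E)
    (E := fun x : M ↦ TangentSpace I x →L[ℝ] TangentSpace I x) x (A x))

/-- `b ∈ Γ (T*M ⊗ T*M)`. -/
def BilinField.Smooth [IsManifold I 1 M] (b : BilinField I M) : Prop :=
  ContMDiff I (I.prod 𝓘(ℝ, E →L[ℝ] E →L[ℝ] ℝ)) ∞ (fun x ↦ TotalSpace.mk' (E →L[ℝ] E →L[ℝ] ℝ)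
    (E := fun x : M ↦ TangentSpace I x →L[ℝ] TangentSpace I x →L[ℝ] ℝ) x (b x))

/-- The vector field `A X`. -/
abbrev EndField.app (A : EndField I M) (X : VField I M) : VField I M := fun x ↦ A x (X x)

/-- The function `b(X, Y)`. -/
abbrev BilinField.app (b : BilinField I M) (X Y : VField I M) : M → ℝ := fun x ↦ b x (X x) (Y x)

instance instFiniteDimensionalTangentSpace [FiniteDimensional ℝ E] (x : M) : FiniteDimensional ℝ (TangentSpace I x) :=
  inferInstanceAs (FiniteDimensional ℝ E)

instance instT2SpaceTangentSpace (x : M) : T2Space (TangentSpace I x) := inferInstanceAs (T2Space E)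

theorem EndField.Smooth.mdiff [IsManifold I 1 M] {A : EndField I M} (hA : A.Smooth)
    {X : VField I M} {x : M}
    (hX : MDiffAt (T% X) x) : MDiffAt (T% (A.app X)) x :=
  MDifferentiableAt.clm_bundle_apply ((hA x).mdifferentiableAt (by simp)) hX

theorem BilinField.Smooth.mdiff [IsManifold I 1 M] {b : BilinField I M} (hb : b.Smooth)
    {X Y : VField I M} {x : M}
    (hX : MDiffAt (T% X) x) (hY : MDiffAt (T% Y) x) : MDiffAt (b.app X Y) x := by
  have := MDifferentiableAt.clm_bundle_apply₂ (F₁ := E) (F₂ := E) (F₃ := ℝ)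
    (E₃ := Bundle.Trivial M ℝ) ((hb x).mdifferentiableAt (by simp)) hX hY
  simpa using! (mdifferentiableAt_totalSpace I _).1 this |>.2

end Tensors

/-! ### Tangent structures, normalizations and metrics -/

section TangentStructures

variable {E : Type*} [NormedAddCommGroup E] [NormedSpace ℝ E] [FiniteDimensional ℝ E]
  {H : Type*} [TopologicalSpace H] (I : ModelWithCorners ℝ E H)
  (M : Type*) [TopologicalSpace M] [ChartedSpace H M] [IsManifold I ∞ M]

/-- An almost tangent structure on `M`: a smooth field `S` of endomorphisms of `TM` with
`im S = ker S` (hence `S² = 0`). -/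
structure AlmostTangentStructure where
  S : EndField I M
  smooth : S.Smooth
  range_eq_ker : ∀ x, (S x).range = (S x).ker

variable {I M}

/-- A normalization of an almost tangent structure: a smooth distribution `NV` (the horizontal
bundle) with `TM = NV ⊕ im S`. Smoothness of the decomposition is smoothness, as a tensor field, of
the projection onto `NV` along `im S`. -/
structure Normalization (𝒮 : AlmostTangentStructure I M) where
  /-- The fibres of the horizontal bundle. -/
  horizontal : ∀ x : M, Submodule ℝ (TangentSpace I x)
  isCompl : ∀ x : M, IsCompl (horizontal x) (𝒮.S x).range
  smooth : EndField.Smooth (I := I) (M := M) fun x ↦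
    LinearMap.toContinuousLinearMap ((horizontal x).projection _ (isCompl x))

namespace Normalization

variable {𝒮 : AlmostTangentStructure I M} (N : Normalization 𝒮)

/-- The projection `p_N` onto the horizontal bundle, along `TV = im S`. -/
def pN : EndField I M := fun x ↦
  LinearMap.toContinuousLinearMap ((N.horizontal x).projection _ (N.isCompl x))

/-- The projection `p_T = Id - p_N` onto the vertical bundle `TV = im S`, along `NV`. -/
def pT : EndField I M := fun x ↦ ContinuousLinearMap.id ℝ _ - N.pN x

/-- The isomorphism `Q : NV → TV` given by the restriction of `S`. -/
def Q (x : M) : N.horizontal x ≃ₗ[ℝ] (𝒮.S x).range :=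
  LinearEquiv.ofBijective ((𝒮.S x).toLinearMap.rangeRestrict ∘ₗ (N.horizontal x).subtype) (by
    constructor
    · rw [← LinearMap.ker_eq_bot, LinearMap.ker_comp, LinearMap.ker_rangeRestrict]
      rw [← Submodule.disjoint_iff_comap_eq_bot, ← 𝒮.range_eq_ker]
      exact (N.isCompl x).disjoint
    · rintro ⟨_, u, rfl⟩
      obtain ⟨a, ha, b, hb, rfl⟩ := Submodule.mem_sup.1
        ((N.isCompl x).sup_eq_top ▸ Submodule.mem_top : u ∈ N.horizontal x ⊔ (𝒮.S x).range)
      rw [𝒮.range_eq_ker] at hb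
      refine ⟨⟨a, ha⟩, Subtype.ext ?_⟩
      simpa using! hb)

/-- The tensor field `0 ⊕ Q⁻¹` with respect to `TM = NV ⊕ TV`: it vanishes on horizontal vectors
and maps `S u` to `u` for `u` horizontal. -/
def Sinv : EndField I M := fun x ↦ LinearMap.toContinuousLinearMap
  ((N.horizontal x).subtype ∘ₗ (N.Q x).symm.toLinearMap ∘ₗ
    (𝒮.S x).range.projectionOnto _ (N.isCompl x).symm)

theorem pN_mem (x : M) (u : TangentSpace I x) : N.pN x u ∈ N.horizontal x := by
  simp [pN]

theorem pN_of_mem {x : M} {u : TangentSpace I x} (h : u ∈ N.horizontal x) : N.pN x u = u := by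
  simp [pN, h]

theorem pN_pN (x : M) (u : TangentSpace I x) : N.pN x (N.pN x u) = N.pN x u :=
  N.pN_of_mem (N.pN_mem x u)

theorem pN_S (x : M) (u : TangentSpace I x) : N.pN x (𝒮.S x u) = 0 := by
  simp [pN]

theorem pN_pT (x : M) (u : TangentSpace I x) : N.pN x (N.pT x u) = 0 := by
  simp [pT, pN_pN]

theorem pT_pN (x : M) (u : TangentSpace I x) : N.pT x (N.pN x u) = 0 := by
  simp [pT, pN_pN]

theorem pN_add_pT (x : M) (u : TangentSpace I x) : N.pN x u + N.pT x u = u := by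
  simp [pT]

theorem pT_pT (x : M) (u : TangentSpace I x) : N.pT x (N.pT x u) = N.pT x u := by
  simp [pT, pN_pN]

theorem pT_S (x : M) (u : TangentSpace I x) : N.pT x (𝒮.S x u) = 𝒮.S x u := by
  simp [pT, pN_S]

theorem S_pN (x : M) (u : TangentSpace I x) : 𝒮.S x (N.pN x u) = 𝒮.S x u := by
  have h : u - N.pN x u ∈ (𝒮.S x).range := by
    rw [← Submodule.projection_apply_eq_zero_iff (N.isCompl x)]
    simpa [pN, sub_eq_zero] using! (N.pN_pN x u).symm
  rw [𝒮.range_eq_ker] at h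
  exact (sub_eq_zero.1 (by simpa using! h)).symm

theorem Sinv_pN (x : M) (u : TangentSpace I x) : N.Sinv x (N.pN x u) = 0 := by
  simp [Sinv, pN]

theorem S_Sinv (x : M) (u : TangentSpace I x) : 𝒮.S x (N.Sinv x u) = N.pT x u := by
  have h : ∀ y, 𝒮.S x ((N.Q x).symm y : TangentSpace I x) = y := fun y ↦
    congrArg Subtype.val ((N.Q x).apply_symm_apply y)
  have h2 := Submodule.projection_add_projection_eq_self (N.isCompl x) u
  simp only [Sinv, pT, pN, LinearMap.coe_toContinuousLinearMap', LinearMap.comp_apply,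
    Submodule.subtype_apply, LinearEquiv.coe_coe, h, Submodule.coe_projectionOnto_apply,
    sub_apply, ContinuousLinearMap.id_apply]
  exact eq_sub_of_add_eq' h2

theorem eq_of_S_eq {x : M} {u v : TangentSpace I x} (h : 𝒮.S x u = 𝒮.S x v) :
    N.pN x u = N.pN x v := by
  have h : u - v ∈ (𝒮.S x).range := by
    rw [𝒮.range_eq_ker]
    simpa [sub_eq_zero] using! h
  obtain ⟨w, hw⟩ := h
  have := N.pN_S x w
  rw [show 𝒮.S x w = u - v from hw, map_sub, sub_eq_zero] at this
  exact this

theorem pN_Sinv (x : M) (u : TangentSpace I x) : N.pN x (N.Sinv x u) = N.Sinv x u :=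
  N.pN_of_mem (by simp [Sinv])

theorem Sinv_S (x : M) (u : TangentSpace I x) : N.Sinv x (𝒮.S x u) = N.pN x u := by
  rw [← N.pN_Sinv]
  exact N.eq_of_S_eq (by rw [S_Sinv, pT_S])

theorem pN_smooth : N.pN.Smooth := N.smooth

theorem pT_mdiff {X : VField I M} {x : M} (hX : MDiffAt (T% X) x) :
    MDiffAt (T% (N.pT.app X)) x :=
  mdifferentiableAt_sub_section hX (N.pN_smooth.mdiff hX)

theorem Sinv_smooth : N.Sinv.Smooth := by
  intro x₀
  have hP := (contMDiffAt_hom_bundle _).1 (N.pN_smooth x₀)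
  have hS := (contMDiffAt_hom_bundle _).1 (𝒮.smooth x₀)
  rw [contMDiffAt_hom_bundle]
  refine ⟨hP.1, ?_⟩
  let c (A : EndField I M) (x : M) : E →L[ℝ] E :=
    ContinuousLinearMap.inCoordinates E (TangentSpace I) E (TangentSpace I) x₀ x x₀ x (A x)
  let e := trivializationAt E (TangentSpace I) x₀
  have hx₀ : x₀ ∈ e.baseSet := FiberBundle.mem_baseSet_trivializationAt' x₀
  have hc : ∀ x ∈ e.baseSet, ∃ Φ : TangentSpace I x ≃L[ℝ] E, ∀ (A : EndField I M) (v : E),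
      c A x v = Φ (A x (Φ.symm v)) := fun x hx ↦
    ⟨e.continuousLinearEquivAt ℝ x hx, fun A v ↦
      congrArg (fun f : E →L[ℝ] E ↦ f v) (ContinuousLinearMap.inCoordinates_eq hx hx)⟩
  -- the relations between `S`, `Sinv`, `p_N` in the trivialization
  have h1 : ∀ x ∈ e.baseSet, c 𝒮.S x * c N.Sinv x = 1 - c N.pN x := by
    intro x hx
    obtain ⟨Φ, hΦ⟩ := hc x hx
    ext v
    simp [hΦ, S_Sinv, pT]
  have h2 : ∀ x ∈ e.baseSet, c N.pN x * c N.Sinv x = c N.Sinv x := by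
    intro x hx
    obtain ⟨Φ, hΦ⟩ := hc x hx
    ext v
    simp [hΦ, pN_Sinv]
  have h3 : ∀ x ∈ e.baseSet, c N.Sinv x * c 𝒮.S x = c N.pN x := by
    intro x hx
    obtain ⟨Φ, hΦ⟩ := hc x hx
    ext v
    simp [hΦ, Sinv_S]
  have h4 : ∀ x ∈ e.baseSet, c N.Sinv x * c N.pN x = 0 := by
    intro x hx
    obtain ⟨Φ, hΦ⟩ := hc x hx
    ext v
    simp [hΦ, Sinv_pN]
  have h5 : ∀ x ∈ e.baseSet, c 𝒮.S x * c 𝒮.S x = 0 := by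
    intro x hx
    obtain ⟨Φ, hΦ⟩ := hc x hx
    ext v
    have : ∀ u, 𝒮.S x (𝒮.S x u) = 0 := fun u ↦ by
      have : 𝒮.S x u ∈ (𝒮.S x).ker := 𝒮.range_eq_ker x ▸ ⟨u, rfl⟩
      exact this
    simp [hΦ, this]
  let G (x : M) : E →L[ℝ] E := c N.pN x * c N.Sinv x₀ * (1 - c N.pN x) + c 𝒮.S x
  have hG : ContMDiffAt I 𝓘(ℝ, E →L[ℝ] E) ∞ G x₀ :=
    ((hP.2.clm_comp contMDiffAt_const).clm_comp (contMDiffAt_const.sub hP.2)).add hS.2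
  have h00 : c N.Sinv x₀ * c N.Sinv x₀ = 0 := by
    rw [← h2 x₀ hx₀, ← mul_assoc, mul_assoc (c N.pN x₀), h4 x₀ hx₀]
    simp
  have hG0 : G x₀ = c N.Sinv x₀ + c 𝒮.S x₀ := by
    simp only [G, h2 x₀ hx₀, mul_sub, h4 x₀ hx₀]
    simp
  have hGG : G x₀ * G x₀ = 1 := by
    rw [hG0, add_mul, mul_add, mul_add, h00, h1 x₀ hx₀, h3 x₀ hx₀, h5 x₀ hx₀]
    simp
  let U : (E →L[ℝ] E)ˣ := ⟨G x₀, G x₀, hGG, hGG⟩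
  have hinv : ContMDiffAt I 𝓘(ℝ, E →L[ℝ] E) ∞ (fun x ↦ Ring.inverse (G x)) x₀ := by
    have : CompleteSpace E := FiniteDimensional.complete ℝ E
    exact ((contDiffAt_ringInverse ℝ U).contMDiffAt).comp x₀ hG
  have hfin : ContMDiffAt I 𝓘(ℝ, E →L[ℝ] E) ∞
      (fun x ↦ Ring.inverse (G x) * (1 - c N.pN x)) x₀ :=
    hinv.clm_comp (contMDiffAt_const.sub hP.2)
  refine hfin.congr_of_eventuallyEq ?_
  have hu : ∀ᶠ x in 𝓝 x₀, IsUnit (G x) :=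
    hG.continuousAt.eventually (Units.nhds U)
  filter_upwards [hu, e.open_baseSet.mem_nhds hx₀] with x hx hxe
  change c N.Sinv x = _
  have : G x * c N.Sinv x = 1 - c N.pN x := by
    rw [← h1 x hxe]
    simp only [G, add_mul, mul_assoc, sub_mul, h2 x hxe]
    simp
  rw [← this, ← mul_assoc, Ring.inverse_mul_cancel _ hx, one_mul]

end Normalization

/-- A (possibly indefinite) metric of the transversal bundle `νV = TM / im S`, seen as a symmetric
covariant 2-tensor field on `M`: it descends to the quotient and is nondegenerate there, i.e. its
null space at each point is exactly `im S`. -/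
structure TransversalMetric (𝒮 : AlmostTangentStructure I M) where
  form : BilinField I M
  smooth : form.Smooth
  symm : ∀ x u v, form x u v = form x v u
  degenerate_iff : ∀ x u, (∀ v, form x u v = 0) ↔ u ∈ (𝒮.S x).range

variable (I M) in
/-- A pseudo-Riemannian metric on `M`. -/
structure PseudoRiemannianMetric where
  form : BilinField I M
  smooth : form.Smooth
  symm : ∀ x u v, form x u v = form x v u
  nondegenerate : ∀ x u, (∀ v, form x u v = 0) → u = 0

namespace Normalization

variable {𝒮 : AlmostTangentStructure I M} (N : Normalization 𝒮)

/-- The bilinear form `γ` of the canonical extension of `g`: `γ = g` on `NV`, the bundles `NV` and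
`TV` are orthogonal, and `γ(SX, SY) = g(X, Y)` for horizontal `X`, `Y`. -/
def extensionForm (g : TransversalMetric 𝒮) : BilinField I M := fun x ↦
  ContinuousLinearMap.precomp ℝ (N.pN x) ∘L g.form x ∘L N.pN x +
    ContinuousLinearMap.precomp ℝ (N.Sinv x) ∘L g.form x ∘L N.Sinv x

theorem extensionForm_apply (g : TransversalMetric 𝒮) (x : M) (u v : TangentSpace I x) :
    N.extensionForm g x u v =
      g.form x (N.pN x u) (N.pN x v) + g.form x (N.Sinv x u) (N.Sinv x v) := rfl

theorem extensionForm_smooth (g : TransversalMetric 𝒮) : (N.extensionForm g).Smooth := by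
  intro x₀
  refine contMDiffAt_hom_of_apply fun e ↦ contMDiffAt_hom_of_apply fun f ↦ ?_
  have he := contMDiffAt_symmL_apply (I := I) (V := (TangentSpace I : M → Type _)) x₀ e
  have hf := contMDiffAt_symmL_apply (I := I) (V := (TangentSpace I : M → Type _)) x₀ f
  have h : ∀ A : EndField I M, A.Smooth → _ := fun A hA ↦
    ContMDiffAt.clm_bundle_apply₂ (F₁ := E) (F₂ := E) (F₃ := ℝ)
      (E₃ := Bundle.Trivial M ℝ) (g.smooth x₀) ((hA x₀).clm_bundle_apply he)
      ((hA x₀).clm_bundle_apply hf)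
  have h1 := (h _ N.pN_smooth).add_section (h _ N.Sinv_smooth)
  exact h1

/-- The canonical extension of a transversal metric `g`: the unique pseudo-Riemannian metric `γ`
that agrees with `g` on `NV`, makes `NV` and `TV` orthogonal, and satisfies `γ(SX, SY) = γ(X, Y)`
for horizontal `X`, `Y`. -/
def canonicalExtension (g : TransversalMetric 𝒮) : PseudoRiemannianMetric I M where
  form := N.extensionForm g
  smooth := N.extensionForm_smooth g
  symm x u v := by simp only [extensionForm_apply, g.symm x (N.pN x u), g.symm x (N.Sinv x u)]
  nondegenerate x u h := by
    have g0 : ∀ v w, g.form x v (𝒮.S x w) = 0 := fun v w ↦ by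
      rw [g.symm]
      exact (g.degenerate_iff x _).2 ⟨w, rfl⟩ v
    have gN : ∀ v w, g.form x v (N.pN x w) = g.form x v w := fun v w ↦ by
      have h2 := g0 v (N.Sinv x w)
      rw [S_Sinv, pT] at h2
      simp only [sub_apply, ContinuousLinearMap.id_apply, map_sub] at h2
      exact (sub_eq_zero.1 h2).symm
    have key : ∀ w, N.pN x w = w → (∀ v, g.form x w v = 0) → w = 0 := fun w hw hv ↦ by
      obtain ⟨z, hz⟩ := (g.degenerate_iff x w).1 hv
      rw [← hw, ← hz]
      exact N.pN_S x z
    have h1 : N.pN x u = 0 := key _ (N.pN_pN x u) fun v ↦ by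
      have := h (N.pN x v)
      rwa [extensionForm_apply, Sinv_pN, map_zero, add_zero, pN_pN, gN] at this
    have h2 : N.Sinv x u = 0 := key _ (N.pN_Sinv x u) fun v ↦ by
      have := h (𝒮.S x v)
      rwa [extensionForm_apply, pN_S, map_zero, zero_add, Sinv_S, gN] at this
    have h3 := N.S_Sinv x u
    rw [h2, map_zero, pT, sub_apply, h1, sub_zero] at h3
    exact h3.symm

end Normalization

/-- `X ∈ Γ NV`: a smooth horizontal vector field. -/
def Normalization.IsHorizontal {𝒮 : AlmostTangentStructure I M} (N : Normalization 𝒮)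
    (X : VField I M) : Prop :=
  X.Smooth ∧ ∀ x, X x ∈ N.horizontal x

end TangentStructures

/-! ### The Levi-Civita connection and the canonical connection -/

section Connections

variable {E : Type*} [NormedAddCommGroup E] [NormedSpace ℝ E] [FiniteDimensional ℝ E]
  {H : Type*} [TopologicalSpace H] {I : ModelWithCorners ℝ E H}
  {M : Type*} [TopologicalSpace M] [ChartedSpace H M] [IsManifold I ∞ M]

namespace PseudoRiemannianMetric

variable (γ : PseudoRiemannianMetric I M)

/-- The right-hand side of the Koszul formula
`2 γ(∇_X Y, Z) = X γ(Y,Z) + Y γ(X,Z) - Z γ(X,Y) + γ([X,Y],Z) - γ([X,Z],Y) - γ([Y,Z],X)`. -/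
def koszul (X Y Z : VField I M) (x : M) : ℝ :=
  mvfderiv I (γ.form.app Y Z) x (X x) + mvfderiv I (γ.form.app X Z) x (Y x)
    - mvfderiv I (γ.form.app X Y) x (Z x)
    + γ.form x (mlieBracket I X Y x) (Z x) - γ.form x (mlieBracket I X Z x) (Y x)
    - γ.form x (mlieBracket I Y Z x) (X x)

theorem app_smul_left (f : M → ℝ) (X Y : VField I M) :
    γ.form.app (f • X) Y = f * γ.form.app X Y := by
  ext x; simp [BilinField.app]

theorem app_smul_right (f : M → ℝ) (X Y : VField I M) :
    γ.form.app X (f • Y) = f * γ.form.app X Y := by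
  ext x; simp [BilinField.app]

theorem app_add_left (X X' Y : VField I M) :
    γ.form.app (X + X') Y = γ.form.app X Y + γ.form.app X' Y := by
  ext x; simp [BilinField.app]

theorem app_add_right (X Y Y' : VField I M) :
    γ.form.app X (Y + Y') = γ.form.app X Y + γ.form.app X Y' := by
  ext x; simp [BilinField.app]

theorem koszul_tensorial_left {Y Z : VField I M} {x : M} (hY : MDiffAt (T% Y) x)
    (hZ : MDiffAt (T% Z) x) : TensorialAt I E (fun X ↦ γ.koszul X Y Z x) x where
  smul {f X} hf hX := by
    have : CompleteSpace E := FiniteDimensional.complete ℝ E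
    have h1 := γ.smooth.mdiff hX hZ
    have h2 := γ.smooth.mdiff hX hY
    simp [koszul, app_smul_left, mlieBracket_smul_left hf hX, mvfderiv_mul hf h1,
      mvfderiv_mul hf h2]
    ring
  add {X X'} hX hX' := by
    have : CompleteSpace E := FiniteDimensional.complete ℝ E
    have h1 := γ.smooth.mdiff hX hZ
    have h2 := γ.smooth.mdiff hX hY
    have h1' := γ.smooth.mdiff hX' hZ
    have h2' := γ.smooth.mdiff hX' hY
    simp [koszul, app_add_left, mlieBracket_add_left hX hX', mvfderiv_add h1 h1',
      mvfderiv_add h2 h2']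
    ring

theorem koszul_tensorial_right {X Y : VField I M} {x : M} (hX : MDiffAt (T% X) x)
    (hY : MDiffAt (T% Y) x) : TensorialAt I E (fun Z ↦ γ.koszul X Y Z x) x where
  smul {f Z} hf hZ := by
    have : CompleteSpace E := FiniteDimensional.complete ℝ E
    have h1 := γ.smooth.mdiff hY hZ
    have h2 := γ.smooth.mdiff hX hZ
    simp [koszul, app_smul_right, mlieBracket_smul_right hf hZ, mvfderiv_mul hf h1,
      mvfderiv_mul hf h2, γ.symm x (Z x)]
    ring
  add {Z Z'} hZ hZ' := by
    have : CompleteSpace E := FiniteDimensional.complete ℝ E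
    have h1 := γ.smooth.mdiff hY hZ
    have h2 := γ.smooth.mdiff hX hZ
    have h1' := γ.smooth.mdiff hY hZ'
    have h2' := γ.smooth.mdiff hX hZ'
    simp [koszul, app_add_right, mlieBracket_add_right hZ hZ', mvfderiv_add h1 h1',
      mvfderiv_add h2 h2']
    ring

/-- The bilinear form `(X, Z) ↦ koszul X Y Z x` on the tangent space. -/
def koszulForm (Y : VField I M) (x : M) (hY : MDiffAt (T% Y) x) :
    TangentSpace I x →L[ℝ] TangentSpace I x →L[ℝ] ℝ :=
  TensorialAt.mkHom₂ (I := I) (F := E) (F' := E) (fun X Z ↦ γ.koszul X Y Z x) x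
    (fun _ hZ ↦ γ.koszul_tensorial_left hY hZ) (fun _ hX ↦ γ.koszul_tensorial_right hX hY)

theorem koszulForm_apply {X Y Z : VField I M} {x : M} (hX : MDiffAt (T% X) x)
    (hY : MDiffAt (T% Y) x) (hZ : MDiffAt (T% Z) x) :
    γ.koszulForm Y x hY (X x) (Z x) = γ.koszul X Y Z x :=
  TensorialAt.mkHom₂_apply (I := I) (F := E) (F' := E)
    (fun _ hZ ↦ γ.koszul_tensorial_left hY hZ) (fun _ hX ↦ γ.koszul_tensorial_right hX hY) hX hZ

/-- `γ_x` as an isomorphism from the tangent space to the cotangent space. -/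
def flat (x : M) : TangentSpace I x ≃ₗ[ℝ] (TangentSpace I x →L[ℝ] ℝ) :=
  LinearEquiv.ofBijective (γ.form x).toLinearMap (by
    have hinj : Function.Injective (γ.form x).toLinearMap := by
      rw [injective_iff_map_eq_zero]
      intro u hu
      exact γ.nondegenerate x u fun v ↦ congrArg (fun f : TangentSpace I x →L[ℝ] ℝ ↦ f v) hu
    have hdim : Module.finrank ℝ (TangentSpace I x) =
        Module.finrank ℝ (TangentSpace I x →L[ℝ] ℝ) := by
      rw [← (LinearMap.toContinuousLinearMap
        (E := TangentSpace I x) (F' := ℝ) (𝕜 := ℝ)).finrank_eq]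
      exact (Subspace.dual_finrank_eq).symm
    have := LinearEquiv.finiteDimensional (LinearMap.toContinuousLinearMap
      (E := TangentSpace I x) (F' := ℝ) (𝕜 := ℝ))
    exact ⟨hinj, (LinearMap.injective_iff_surjective_of_finrank_eq_finrank hdim).1 hinj⟩)

open Classical in
/-- The covariant differential `v ↦ ∇_v Y` at `x` of the Levi-Civita connection, by the Koszul
formula (zero by convention where `Y` is not differentiable). -/
def leviCivitaFun (Y : VField I M) (x : M) : TangentSpace I x →L[ℝ] TangentSpace I x :=
  if hY : MDiffAt (T% Y) x then
    LinearMap.toContinuousLinearMap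
      ((1 / 2 : ℝ) • ((γ.flat x).symm.toLinearMap ∘ₗ (γ.koszulForm Y x hY).toLinearMap))
  else 0

theorem two_mul_leviCivitaFun {X Y Z : VField I M} {x : M} (hX : MDiffAt (T% X) x)
    (hY : MDiffAt (T% Y) x) (hZ : MDiffAt (T% Z) x) :
    2 * γ.form x (γ.leviCivitaFun Y x (X x)) (Z x) = γ.koszul X Y Z x := by
  have h : ∀ φ, γ.form x ((γ.flat x).symm φ) = φ := fun φ ↦ (γ.flat x).apply_symm_apply φ
  rw [leviCivitaFun, dif_pos hY]
  simp [h, γ.koszulForm_apply hX hY hZ]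

theorem leviCivitaFun_ext {x : M} {A B : TangentSpace I x →L[ℝ] TangentSpace I x}
    (h : ∀ X Z : VField I M, MDiffAt (T% X) x → MDiffAt (T% Z) x →
      γ.form x (A (X x)) (Z x) = γ.form x (B (X x)) (Z x)) : A = B := by
  ext v
  rw [← sub_eq_zero]
  refine γ.nondegenerate x _ fun w ↦ ?_
  have := h (FiberBundle.extend E v) (FiberBundle.extend E w)
    (FiberBundle.mdifferentiableAt_extend ..) (FiberBundle.mdifferentiableAt_extend ..)
  simpa [sub_eq_zero] using this

/-- The Levi-Civita connection of `γ`: `∇_X Y` is determined by the Koszul formula. -/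
def leviCivita : CovariantDerivative I E (TangentSpace I : M → Type _) where
  toFun := γ.leviCivitaFun
  isCovariantDerivativeOnUniv :=
    { add := fun {Y Y' x} hY hY' _ ↦ by
        have : CompleteSpace E := FiniteDimensional.complete ℝ E
        refine γ.leviCivitaFun_ext fun X Z hX hZ ↦ ?_
        have h0 := γ.two_mul_leviCivitaFun hX (mdifferentiableAt_add_section hY hY') hZ
        have h1 := γ.two_mul_leviCivitaFun hX hY hZ
        have h2 := γ.two_mul_leviCivitaFun hX hY' hZ
        have e : γ.koszul X (Y + Y') Z x = γ.koszul X Y Z x + γ.koszul X Y' Z x := by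
          simp [koszul, app_add_left, app_add_right, mlieBracket_add_left hY hY',
            mlieBracket_add_right hY hY',
            mvfderiv_add (γ.smooth.mdiff hY hZ) (γ.smooth.mdiff hY' hZ),
            mvfderiv_add (γ.smooth.mdiff hX hY) (γ.smooth.mdiff hX hY')]
          ring
        simp only [add_apply, map_add]
        linarith
      leibniz := fun {Y f x} hY hf _ ↦ by
        have : CompleteSpace E := FiniteDimensional.complete ℝ E
        refine γ.leviCivitaFun_ext fun X Z hX hZ ↦ ?_
        have h0 := γ.two_mul_leviCivitaFun hX (hf.smul_section hY) hZ
        have h1 := γ.two_mul_leviCivitaFun hX hY hZ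
        have e : γ.koszul X (f • Y) Z x = f x * γ.koszul X Y Z x
            + 2 * (mvfderiv I f x (X x) * γ.form x (Y x) (Z x)) := by
          simp [koszul, app_smul_left, app_smul_right, mlieBracket_smul_left hf hY,
            mlieBracket_smul_right hf hY, mvfderiv_mul hf (γ.smooth.mdiff hY hZ),
            mvfderiv_mul hf (γ.smooth.mdiff hX hY), γ.symm x (X x) (Y x)]
          ring
        simp
        change 2 * γ.form x (γ.leviCivitaFun (f • Y) x (X x)) (Z x) = _ at h0
        linear_combination (1 / 2) * h0 + (1 / 2) * e - (1 / 2) * f x * h1 }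

end PseudoRiemannianMetric

namespace Normalization

variable {𝒮 : AlmostTangentStructure I M} (N : Normalization 𝒮) (g : TransversalMetric 𝒮)

/-- The formula for `D_X Y`, where `D` is the canonical connection and `∇` is the Levi-Civita
connection of the canonical extension of `g`. It is obtained by additivity from
`D_{Z₁} Z₂ = p_N ∇_{Z₁} Z₂`, `D_{Y₁} Y₂ = p_T ∇_{Y₁} Y₂`, `D_{Y₁} Z₂ = p_N [Y₁, Z₂]` and
`D_{Z₁} Y₂ = p_T [Z₁, Y₂]` for `Z₁`, `Z₂` horizontal and `Y₁`, `Y₂` vertical. -/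
def canonicalFormula (X Y : VField I M) (x : M) : TangentSpace I x :=
  letI nabla := (N.canonicalExtension g).leviCivita
  N.pN x (nabla (N.pN.app Y) x (N.pN x (X x)))
    + N.pT x (nabla (N.pT.app Y) x (N.pT x (X x)))
    + N.pN x (mlieBracket I (N.pT.app X) (N.pN.app Y) x)
    + N.pT x (mlieBracket I (N.pN.app X) (N.pT.app Y) x)

theorem app_add (A : EndField I M) (X Y : VField I M) : A.app (X + Y) = A.app X + A.app Y := by
  ext x; simp [EndField.app]

theorem app_smul (A : EndField I M) (f : M → ℝ) (X : VField I M) :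
    A.app (f • X) = f • A.app X := by
  ext x; simp [EndField.app]

theorem canonicalFormula_tensorial (Y : VField I M) (x : M) :
    TensorialAt I E (fun X ↦ N.canonicalFormula g X Y x) x where
  smul {f X} hf hX := by
    have : CompleteSpace E := FiniteDimensional.complete ℝ E
    have h1 := N.pT_mdiff hX
    have h2 := N.pN_smooth.mdiff hX
    simp [canonicalFormula, app_smul, mlieBracket_smul_left hf h1, mlieBracket_smul_left hf h2,
      pN_pT, pT_pN]
  add {X X'} hX hX' := by
    have : CompleteSpace E := FiniteDimensional.complete ℝ E
    simp [canonicalFormula, app_add, mlieBracket_add_left (N.pT_mdiff hX) (N.pT_mdiff hX'),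
      mlieBracket_add_left (N.pN_smooth.mdiff hX) (N.pN_smooth.mdiff hX')]
    abel

/-- The canonical connection `D` of `(M, S, NV, g)`, as a covariant derivative on `TM`. -/
def canonicalConnection : CovariantDerivative I E (TangentSpace I : M → Type _) where
  toFun Y x := TensorialAt.mkHom (fun X ↦ N.canonicalFormula g X Y x) x
    (N.canonicalFormula_tensorial g Y x)
  isCovariantDerivativeOnUniv :=
    { add := fun {Y Y' x} hY hY' _ ↦ by
        have : CompleteSpace E := FiniteDimensional.complete ℝ E
        ext v
        simp only [TensorialAt.mkHom_apply_eq_extend, add_apply]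
        simp [canonicalFormula, app_add,
          mlieBracket_add_right (N.pT_mdiff hY) (N.pT_mdiff hY'),
          mlieBracket_add_right (N.pN_smooth.mdiff hY) (N.pN_smooth.mdiff hY'),
          (CovariantDerivative.isCovariantDerivativeOn _).add (N.pT_mdiff hY) (N.pT_mdiff hY'),
          (CovariantDerivative.isCovariantDerivativeOn _).add (N.pN_smooth.mdiff hY)
            (N.pN_smooth.mdiff hY')]
        abel
      leibniz := fun {Y f x} hY hf _ ↦ by
        have : CompleteSpace E := FiniteDimensional.complete ℝ E
        ext v
        simp only [TensorialAt.mkHom_apply_eq_extend, add_apply]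
        simp [canonicalFormula, app_smul,
          mlieBracket_smul_right hf (N.pT_mdiff hY),
          mlieBracket_smul_right hf (N.pN_smooth.mdiff hY),
          (CovariantDerivative.isCovariantDerivativeOn _).leibniz (N.pT_mdiff hY) hf,
          (CovariantDerivative.isCovariantDerivativeOn _).leibniz (N.pN_smooth.mdiff hY) hf,
          TensorialAt.mkHom_apply_eq_extend, pN_pN, pT_pT]
        have hv : mvfderiv I f x v =
            mvfderiv I f x (N.pN x v) + mvfderiv I f x (N.pT x v) := by
          rw [← map_add, pN_add_pT]
        have hYx := N.pN_add_pT x (Y x)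
        have a1 : N.pT.app (FiberBundle.extend E v) x = N.pT x v := by simp [EndField.app]
        have a2 : N.pN.app (FiberBundle.extend E v) x = N.pN x v := by simp [EndField.app]
        rw [a1, a2, hv]
        conv_rhs => rw [← hYx]
        module }

/-- The defining formula of the canonical connection -/
theorem canonicalConnection_apply {X : VField I M} {x : M} (hX : MDiffAt (T% X) x)
    (Y : VField I M) : N.canonicalConnection g Y x (X x) = N.canonicalFormula g X Y x :=
  TensorialAt.mkHom_apply (N.canonicalFormula_tensorial g Y x) hX

end Normalization

end Connections

/-! ### Curvature and the first Bianchi identity -/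

section BianchiIdentity

variable {E : Type*} [NormedAddCommGroup E] [NormedSpace ℝ E] [FiniteDimensional ℝ E]
  [CompleteSpace E]
  {H : Type*} [TopologicalSpace H] {I : ModelWithCorners ℝ E H}
  {M : Type*} [TopologicalSpace M] [ChartedSpace H M] [IsManifold I ∞ M]

namespace CovariantDerivative

variable (D : CovariantDerivative I E (TangentSpace I : M → Type _))

/-- The vector field `D_X Y`. -/
abbrev along (X Y : VField I M) : VField I M := fun x ↦ D Y x (X x)

/-- The curvature `R_D(X, Y) Z = D_X D_Y Z - D_Y D_X Z - D_{[X,Y]} Z`. -/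
def curvature (X Y Z : VField I M) : VField I M :=
  D.along X (D.along Y Z) - D.along Y (D.along X Z) - D.along (mlieBracket I X Y) Z

/-- The vector field `T_D(X, Y)`, where `T_D(X, Y) = D_X Y - D_Y X - [X, Y]` is the torsion. -/
def torsionField (X Y : VField I M) : VField I M := fun x ↦ D.torsion x (X x) (Y x)

/-- The covariant derivative of the torsion tensor:
`(D_X T_D)(Y, Z) = D_X (T_D(Y, Z)) - T_D(D_X Y, Z) - T_D(Y, D_X Z)`. -/
def derivTorsion (X Y Z : VField I M) : VField I M :=
  D.along X (D.torsionField Y Z) - D.torsionField (D.along X Y) Z - D.torsionField Y (D.along X Z)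

end CovariantDerivative

/-- The cyclic sum `F(X, Y, Z) + F(Y, Z, X) + F(Z, X, Y)`. -/
def cyclicSum (F : VField I M → VField I M → VField I M → VField I M) (X Y Z : VField I M) :
    VField I M :=
  F X Y Z + F Y Z X + F Z X Y

/-- The first Bianchi identity of a linear connection `D` with torsion: for all vector fields,
`∑_cycl R_D(X, Y) Z = ∑_cycl (T_D(T_D(X, Y), Z) + (D_X T_D)(Y, Z))`. -/
def FirstBianchiIdentity (D : CovariantDerivative I E (TangentSpace I : M → Type _)) : Prop :=
  ∀ X Y Z : VField I M, X.Smooth → Y.Smooth → Z.Smooth →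
    cyclicSum D.curvature X Y Z =
      cyclicSum (fun X Y Z ↦ D.torsionField (D.torsionField X Y) Z + D.derivTorsion X Y Z) X Y Z

end BianchiIdentity

/-! ### Tangent manifolds -/

/-- The model space `ℝⁿ × ℝⁿ` of a `2n`-dimensional manifold, with coordinates `(xⁱ, yⁱ)`. -/
abbrev TangentModel (n : ℕ) : Type := EuclideanSpace ℝ (Fin n) × EuclideanSpace ℝ (Fin n)

/-- `S` is a tangent structure, i.e. it is integrable: around every point there is a smooth chart
with coordinates `(xⁱ, yⁱ)` in which `S (∂/∂xⁱ) = ∂/∂yⁱ` and `S (∂/∂yⁱ) = 0`, i.e. the differential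
of the chart sends `S v` to `(0, a)` if it sends `v` to `(a, b)`. -/
def AlmostTangentStructure.IsIntegrable {n : ℕ} {M : Type*} [TopologicalSpace M]
    [ChartedSpace (TangentModel n) M] [IsManifold 𝓘(ℝ, TangentModel n) ∞ M]
    (𝒮 : AlmostTangentStructure 𝓘(ℝ, TangentModel n) M) : Prop :=
  ∀ p : M, ∃ e ∈ IsManifold.maximalAtlas 𝓘(ℝ, TangentModel n) ∞ M, p ∈ e.source ∧
    ∀ x ∈ e.source, ∀ v : TangentSpace 𝓘(ℝ, TangentModel n) x,
      mvfderiv 𝓘(ℝ, TangentModel n) e x (𝒮.S x v) =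
        (0, (mvfderiv 𝓘(ℝ, TangentModel n) e x v).1)

end

section SmoothnessOfLeviCivita

variable {E : Type*} [NormedAddCommGroup E] [NormedSpace ℝ E] [FiniteDimensional ℝ E]
  {H : Type*} [TopologicalSpace H] {I : ModelWithCorners ℝ E H}
  {M : Type*} [TopologicalSpace M] [ChartedSpace H M] [IsManifold I ∞ M]

/-- The derivative of a smooth function along a smooth vector field is smooth. -/
theorem contMDiffAt_mvfderiv_apply {f : M → ℝ} {X : VField I M} {x₀ : M}
    (hf : ContMDiffAt I 𝓘(ℝ, ℝ) ∞ f x₀) (hX : CMDiffAt ∞ (T% X) x₀) :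
    ContMDiffAt I 𝓘(ℝ, ℝ) ∞ (fun x ↦ mvfderiv I f x (X x)) x₀ := by
  have h := hf.mfderiv_const (m := ∞) (by simp)
  have h2 := ContMDiffAt.clm_apply_of_inCoordinates (b₁ := id) (b₂ := f)
    (E₁ := (TangentSpace I : M → Type _)) (E₂ := (TangentSpace 𝓘(ℝ, ℝ) : ℝ → Type _)) h hX hf
  simpa using! (contMDiffAt_totalSpace.1 h2).2

theorem BilinField.Smooth.contMDiffAt_app {b : BilinField I M} (hb : b.Smooth) {X Y : VField I M}
    {x₀ : M} (hX : CMDiffAt ∞ (T% X) x₀) (hY : CMDiffAt ∞ (T% Y) x₀) :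
    ContMDiffAt I 𝓘(ℝ, ℝ) ∞ (b.app X Y) x₀ := by
  have := ContMDiffAt.clm_bundle_apply₂ (F₁ := E) (F₂ := E) (F₃ := ℝ)
    (E₃ := Bundle.Trivial M ℝ) (hb x₀) hX hY
  simpa using! (contMDiffAt_totalSpace.1 this).2

theorem contMDiffAt_mlieBracket {X Y : VField I M} {x₀ : M} (hX : CMDiffAt ∞ (T% X) x₀)
    (hY : CMDiffAt ∞ (T% Y) x₀) : CMDiffAt ∞ (T% (mlieBracket I X Y)) x₀ := by
  have : CompleteSpace E := FiniteDimensional.complete ℝ E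
  have : IsManifold I (((⊤ : ℕ∞) : ℕ∞ω) + 1) M := by simpa
  have : IsManifold I (minSmoothness ℝ 2) M := by
    rw [minSmoothness_of_isRCLikeNormedField]
    infer_instance
  exact ContMDiffAt.mlieBracket_vectorField (m := ⊤) (n := ⊤) hX hY (by simp)

namespace PseudoRiemannianMetric

variable (γ : PseudoRiemannianMetric I M)

theorem contMDiffAt_koszul {X Y Z : VField I M} {x₀ : M} (hX : CMDiffAt ∞ (T% X) x₀)
    (hY : CMDiffAt ∞ (T% Y) x₀) (hZ : CMDiffAt ∞ (T% Z) x₀) :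
    ContMDiffAt I 𝓘(ℝ, ℝ) ∞ (γ.koszul X Y Z) x₀ := by
  have hb {X Y : VField I M} (hX : CMDiffAt ∞ (T% X) x₀) (hY : CMDiffAt ∞ (T% Y) x₀) :=
    γ.smooth.contMDiffAt_app hX hY
  exact (((((contMDiffAt_mvfderiv_apply (hb hY hZ) hX).add
    (contMDiffAt_mvfderiv_apply (hb hX hZ) hY)).sub
    (contMDiffAt_mvfderiv_apply (hb hX hY) hZ)).add
    (hb (contMDiffAt_mlieBracket hX hY) hZ)).sub
    (hb (contMDiffAt_mlieBracket hX hZ) hY)).sub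
    (hb (contMDiffAt_mlieBracket hY hZ) hX)

theorem leviCivita_apply (Y : VField I M) (x : M) : γ.leviCivita Y x = γ.leviCivitaFun Y x := rfl

/-- A vector field is smooth at `x₀` if its products with the constant sections of a local
trivialization are. -/
theorem contMDiffAt_of_form {V : VField I M} {x₀ : M}
    (h : ∀ e : E, ContMDiffAt I 𝓘(ℝ, ℝ) ∞
      (fun x ↦ γ.form x (V x) ((trivializationAt E (TangentSpace I) x₀).symmL ℝ x e)) x₀) :
    CMDiffAt ∞ (T% V) x₀ := by
  have : CompleteSpace E := FiniteDimensional.complete ℝ E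
  let t := trivializationAt E (TangentSpace I : M → Type _) x₀
  have hx₀ : x₀ ∈ t.baseSet := FiberBundle.mem_baseSet_trivializationAt' x₀
  let G (x : M) : E →L[ℝ] E →L[ℝ] ℝ :=
    ContinuousLinearMap.precomp ℝ (t.symmL ℝ x) ∘L γ.form x ∘L t.symmL ℝ x
  have hG : ContMDiffAt I 𝓘(ℝ, E →L[ℝ] E →L[ℝ] ℝ) ∞ G x₀ := by
    refine contMDiffAt_of_forall_apply fun e ↦ contMDiffAt_of_forall_apply fun f ↦ ?_
    exact γ.smooth.contMDiffAt_app (contMDiffAt_symmL_apply x₀ e) (contMDiffAt_symmL_apply x₀ f)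
  let K (x : M) : E →L[ℝ] ℝ := γ.form x (V x) ∘L t.symmL ℝ x
  have hK : ContMDiffAt I 𝓘(ℝ, E →L[ℝ] ℝ) ∞ K x₀ := contMDiffAt_of_forall_apply h
  have hinv : ∀ x ∈ t.baseSet, (G x).IsInvertible := fun x hx ↦ by
    let Φ := t.continuousLinearEquivAt ℝ x hx
    refine ⟨(LinearEquiv.toContinuousLinearEquiv ((Φ.symm.toLinearEquiv.trans (γ.flat x)).trans
      (Φ.arrowCongr (ContinuousLinearEquiv.refl ℝ ℝ)).toLinearEquiv)), ?_⟩
    ext v w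
    have hs : ∀ v, Φ.symm v = t.symmL ℝ x v := fun v ↦ by
      simp [Φ, t.symm_continuousLinearEquivAt_eq]
    have hf : ∀ v w, γ.flat x v w = γ.form x v w := fun _ _ ↦ rfl
    simp [G, hs, hf]
  have hi : ContMDiffAt I 𝓘(ℝ, E) ∞ (fun x ↦ (G x).inverse (K x)) x₀ :=
    ((hinv x₀ hx₀).contDiffAt_map_inverse.contMDiffAt.comp x₀ hG).clm_apply hK
  rw [contMDiffAt_totalSpace]
  refine ⟨contMDiffAt_id, hi.congr_of_eventuallyEq ?_⟩
  filter_upwards [t.open_baseSet.mem_nhds hx₀] with x hx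
  let Φ := t.continuousLinearEquivAt ℝ x hx
  have h1 : K x = G x (Φ (V x)) := by
    have h2 : t.symmL ℝ x (Φ (V x)) = V x :=
      (congrFun (t.symm_continuousLinearEquivAt_eq hx).symm _).trans (Φ.symm_apply_apply _)
    ext w
    simp [K, G, h2]
  rw [h1, (hinv x hx).inverse_apply_eq.2 rfl]
  rfl

theorem contMDiffAt_leviCivita {X Y : VField I M} (hX : X.Smooth) (hY : Y.Smooth) (x₀ : M) :
    CMDiffAt ∞ (T% (fun x ↦ γ.leviCivita Y x (X x))) x₀ := by
  refine γ.contMDiffAt_of_form fun e ↦ ?_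
  let t := trivializationAt E (TangentSpace I : M → Type _) x₀
  have hx₀ : x₀ ∈ t.baseSet := FiberBundle.mem_baseSet_trivializationAt' x₀
  let Z : VField I M := fun x ↦ t.symmL ℝ x e
  have hZ : ∀ x ∈ t.baseSet, CMDiffAt ∞ (T% Z) x := fun x hx ↦ by
    refine ContMDiffAt.clm_bundle_apply (E₁ := Bundle.Trivial M E) (v := fun _ ↦ e)
      (t.contMDiffAt_symmL (IB := I) (n := ∞) hx) ?_
    rw [contMDiffAt_totalSpace]
    exact ⟨contMDiffAt_id, by simpa using! contMDiffAt_const⟩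
  have hk := γ.contMDiffAt_koszul (hX x₀) (hY x₀) (hZ x₀ hx₀)
  refine ((contMDiffAt_const (c := (1 / 2 : ℝ))).mul hk).congr_of_eventuallyEq ?_
  filter_upwards [t.open_baseSet.mem_nhds hx₀] with x hx
  have := γ.two_mul_leviCivitaFun ((hX x).mdifferentiableAt (by simp))
    ((hY x).mdifferentiableAt (by simp)) ((hZ x hx).mdifferentiableAt (by simp))
  simp only [Pi.mul_apply, ← this]
  change γ.form x (γ.leviCivitaFun Y x (X x)) (Z x) = _
  ring

/-- The Levi-Civita connection is torsion-free. -/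
theorem leviCivita_sub {X Y : VField I M} {x : M} (hX : MDiffAt (T% X) x)
    (hY : MDiffAt (T% Y) x) :
    γ.leviCivita Y x (X x) - γ.leviCivita X x (Y x) = mlieBracket I X Y x := by
  have : CompleteSpace E := FiniteDimensional.complete ℝ E
  rw [← sub_eq_zero]
  refine γ.nondegenerate x _ fun w ↦ ?_
  have hZ := FiberBundle.mdifferentiableAt_extend I E w
  have h1 := γ.two_mul_leviCivitaFun hX hY hZ
  have h2 := γ.two_mul_leviCivitaFun hY hX hZ
  have h3 : mlieBracket I Y X x = - mlieBracket I X Y x := mlieBracket_swap_apply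
  have h4 : γ.form.app X Y = γ.form.app Y X := funext fun y ↦ γ.symm y _ _
  simp only [koszul, h3, h4, FiberBundle.extend_apply_self] at h1 h2
  simp only [map_sub, sub_apply, leviCivita_apply]
  simp at h1 h2 ⊢
  linarith

end PseudoRiemannianMetric

end SmoothnessOfLeviCivita

section BianchiForSmoothConnections

variable {E : Type*} [NormedAddCommGroup E] [NormedSpace ℝ E] [FiniteDimensional ℝ E]
  [CompleteSpace E]
  {H : Type*} [TopologicalSpace H] {I : ModelWithCorners ℝ E H}
  {M : Type*} [TopologicalSpace M] [ChartedSpace H M] [IsManifold I ∞ M]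

theorem VField.Smooth.mdiff {X : VField I M} (hX : X.Smooth) (x : M) : MDiffAt (T% X) x :=
  (hX x).mdifferentiableAt (by simp)

theorem VField.Smooth.add {X Y : VField I M} (hX : X.Smooth) (hY : Y.Smooth) :
    VField.Smooth (X + Y) := fun x ↦ (hX x).add_section (hY x)

theorem VField.Smooth.sub {X Y : VField I M} (hX : X.Smooth) (hY : Y.Smooth) :
    VField.Smooth (X - Y) := fun x ↦ (hX x).sub_section (hY x)

theorem VField.Smooth.mlieBracket {X Y : VField I M} (hX : X.Smooth) (hY : Y.Smooth) :
    VField.Smooth (mlieBracket I X Y) := fun x ↦ contMDiffAt_mlieBracket (hX x) (hY x)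

theorem EndField.Smooth.app {A : EndField I M} (hA : A.Smooth) {X : VField I M} (hX : X.Smooth) :
    VField.Smooth (A.app X) := fun x ↦ (hA x).clm_bundle_apply (hX x)

namespace CovariantDerivative

variable (D : CovariantDerivative I E (TangentSpace I : M → Type _))

/-- `D_X Y` is smooth for all smooth vector fields `X` and `Y`. -/
def PreservesSmooth : Prop :=
  ∀ X Y : VField I M, X.Smooth → Y.Smooth → VField.Smooth (D.along X Y)

theorem along_sub (X : VField I M) {A B : VField I M} (hA : A.Smooth) (hB : B.Smooth) :
    D.along X (A - B) = D.along X A - D.along X B := by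
  funext x
  have h := D.isCovariantDerivativeOn.add ((hA.sub hB).mdiff x) (hB.mdiff x)
  rw [sub_add_cancel] at h
  simp [along, h]

theorem torsionField_eq {X Y : VField I M} (hX : X.Smooth) (hY : Y.Smooth) :
    D.torsionField X Y = D.along X Y - D.along Y X - mlieBracket I X Y :=
  funext fun x ↦ D.torsion_apply (hX.mdiff x) (hY.mdiff x)

theorem torsionField_swap (X Y : VField I M) : D.torsionField X Y = - D.torsionField Y X :=
  funext fun x ↦ D.torsion_antisymm (X x) (Y x)

theorem torsionField_sub_left (X X' Y : VField I M) :
    D.torsionField (X - X') Y = D.torsionField X Y - D.torsionField X' Y := by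
  funext x
  simp [torsionField]

theorem torsionField_add_left (X X' Y : VField I M) :
    D.torsionField (X + X') Y = D.torsionField X Y + D.torsionField X' Y := by
  funext x
  simp [torsionField]

theorem torsionField_add_right (X Y Y' : VField I M) :
    D.torsionField X (Y + Y') = D.torsionField X Y + D.torsionField X Y' := by
  funext x
  simp [torsionField]

theorem curvature_swap (X Y Z : VField I M) : D.curvature X Y Z = - D.curvature Y X Z := by
  funext x
  simp only [curvature, along, mlieBracket_swap (V := X) (W := Y), Pi.neg_apply, Pi.sub_apply,
    map_neg]
  abel

variable {D}

theorem PreservesSmooth.torsionField (hD : D.PreservesSmooth) {X Y : VField I M} (hX : X.Smooth)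
    (hY : Y.Smooth) : (D.torsionField X Y).Smooth := by
  rw [D.torsionField_eq hX hY]
  exact ((hD X Y hX hY).sub (hD Y X hY hX)).sub (hX.mlieBracket hY)

/-- The first Bianchi identity of a smooth linear connection with torsion. -/
theorem PreservesSmooth.firstBianchiIdentity (hD : D.PreservesSmooth) :
    FirstBianchiIdentity D := by
  intro X Y Z hX hY hZ
  have : IsManifold I (minSmoothness ℝ 3) M := by
    rw [minSmoothness_of_isRCLikeNormedField]
    exact IsManifold.of_le (n := ∞) (WithTop.coe_le_coe.2 le_top)
  have hs {X : VField I M} (hX : X.Smooth) : CMDiff (minSmoothness ℝ 2) (T% X) := by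
    rw [minSmoothness_of_isRCLikeNormedField]
    exact ContMDiff.of_le hX (WithTop.coe_le_coe.2 le_top)
  have jacobi := leibniz_identity_mlieBracket (hs hX) (hs hY) (hs hZ)
  rw [mlieBracket_swap (V := X) (W := mlieBracket I Y Z),
    mlieBracket_swap (V := Y) (W := mlieBracket I X Z),
    mlieBracket_swap (V := X) (W := Z)] at jacobi
  have hneg : mlieBracket I (-mlieBracket I Z X) Y = - mlieBracket I (mlieBracket I Z X) Y := by
    funext x
    have := mlieBracket_const_smul_left (c := (-1 : ℝ)) (W := Y) ((hZ.mlieBracket hX).mdiff x)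
    simpa using this
  rw [hneg] at jacobi
  have key {X Y Z : VField I M} (hX : X.Smooth) (hY : Y.Smooth) (hZ : Z.Smooth) :
      D.torsionField (D.torsionField X Y) Z + D.derivTorsion X Y Z =
        D.along X (D.along Y Z) - D.along X (D.along Z Y) - D.along X (mlieBracket I Y Z)
        - D.along (mlieBracket I X Y) Z + D.along Z (mlieBracket I X Y)
        + mlieBracket I (mlieBracket I X Y) Z
        - D.torsionField (D.along Y X) Z + D.torsionField (D.along X Z) Y := by
    have h1 := hD Y Z hY hZ
    have h2 := hD Z Y hZ hY
    have h3 := D.torsionField_eq (hX.mlieBracket hY) hZ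
    have h4 : D.along X (D.torsionField Y Z) =
        D.along X (D.along Y Z) - D.along X (D.along Z Y) - D.along X (mlieBracket I Y Z) := by
      rw [D.torsionField_eq hY hZ, D.along_sub X (h1.sub h2) (hY.mlieBracket hZ),
        D.along_sub X h1 h2]
    rw [derivTorsion, h4, D.torsionField_eq hX hY, D.torsionField_sub_left,
      D.torsionField_sub_left, h3, D.torsionField_swap Y (D.along X Z)]
    abel
  simp only [cyclicSum, key hX hY hZ, key hY hZ hX, key hZ hX hY, curvature]
  linear_combination (norm := module) jacobi

end CovariantDerivative

end BianchiForSmoothConnections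

section CanonicalConnection

variable {E : Type*} [NormedAddCommGroup E] [NormedSpace ℝ E] [FiniteDimensional ℝ E]
  [CompleteSpace E]
  {H : Type*} [TopologicalSpace H] {I : ModelWithCorners ℝ E H}
  {M : Type*} [TopologicalSpace M] [ChartedSpace H M] [IsManifold I ∞ M]

namespace Normalization

variable {𝒮 : AlmostTangentStructure I M} (N : Normalization 𝒮) (g : TransversalMetric 𝒮)

theorem pT_app_smooth {X : VField I M} (hX : X.Smooth) : VField.Smooth (N.pT.app X) :=
  hX.sub (N.pN_smooth.app hX)

theorem canonicalConnection_along {X : VField I M} (hX : X.Smooth) (Y : VField I M) :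
    (N.canonicalConnection g).along X Y = N.canonicalFormula g X Y :=
  funext fun x ↦ N.canonicalConnection_apply g (hX.mdiff x) Y

theorem canonicalConnection_preservesSmooth : (N.canonicalConnection g).PreservesSmooth := by
  intro X Y hX hY
  rw [canonicalConnection_along N g hX]
  have hN {X : VField I M} (hX : X.Smooth) := N.pN_smooth.app hX
  have hT {X : VField I M} (hX : X.Smooth) := N.pT_app_smooth hX
  have hL {X Y : VField I M} (hX : X.Smooth) (hY : Y.Smooth) :
      VField.Smooth (fun x ↦ (N.canonicalExtension g).leviCivita Y x (X x)) :=
    (N.canonicalExtension g).contMDiffAt_leviCivita hX hY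
  exact (((hN (hL (hN hX) (hN hY))).add (hT (hL (hT hX) (hT hY)))).add
    (hN ((hT hX).mlieBracket (hN hY)))).add (hT ((hN hX).mlieBracket (hT hY)))

theorem canonicalConnection_apply_extend (Y : VField I M) (x : M) (u : TangentSpace I x) :
    N.canonicalConnection g Y x u = N.canonicalFormula g (FiberBundle.extend E u) Y x := by
  rw [← N.canonicalConnection_apply g (FiberBundle.mdifferentiableAt_extend I E u) Y,
    FiberBundle.extend_apply_self]

/-- The canonical connection preserves the horizontal bundle. -/
theorem pT_canonicalConnection {Y : VField I M} (hY : N.pT.app Y = 0) (x : M)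
    (u : TangentSpace I x) : N.pT x (N.canonicalConnection g Y x u) = 0 := by
  simp [canonicalConnection_apply_extend, canonicalFormula, hY, pT_pN]

/-- The canonical connection preserves the vertical bundle. -/
theorem pN_canonicalConnection {Y : VField I M} (hY : N.pN.app Y = 0) (x : M)
    (u : TangentSpace I x) : N.pN x (N.canonicalConnection g Y x u) = 0 := by
  simp [canonicalConnection_apply_extend, canonicalFormula, hY, pN_pT]

theorem pT_curvature (X Y : VField I M) {Z : VField I M} (hZ : N.pT.app Z = 0) :
    N.pT.app ((N.canonicalConnection g).curvature X Y Z) = 0 := by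
  have h (X : VField I M) : N.pT.app ((N.canonicalConnection g).along X Z) = 0 :=
    funext fun x ↦ N.pT_canonicalConnection g hZ x _
  funext x
  simp only [EndField.app, CovariantDerivative.curvature, CovariantDerivative.along,
    Pi.sub_apply, map_sub]
  rw [N.pT_canonicalConnection g (h Y), N.pT_canonicalConnection g (h X),
    N.pT_canonicalConnection g hZ]
  simp

theorem pN_curvature (X Y : VField I M) {Z : VField I M} (hZ : N.pN.app Z = 0) :
    N.pN.app ((N.canonicalConnection g).curvature X Y Z) = 0 := by
  have h (X : VField I M) : N.pN.app ((N.canonicalConnection g).along X Z) = 0 :=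
    funext fun x ↦ N.pN_canonicalConnection g hZ x _
  funext x
  simp only [EndField.app, CovariantDerivative.curvature, CovariantDerivative.along,
    Pi.sub_apply, map_sub]
  rw [N.pN_canonicalConnection g (h Y), N.pN_canonicalConnection g (h X),
    N.pN_canonicalConnection g hZ]
  simp

theorem pN_app_add_pT_app (X : VField I M) : N.pN.app X + N.pT.app X = X :=
  funext fun x ↦ N.pN_add_pT x (X x)

theorem pT_app_eq_self {X : VField I M} (h : N.pN.app X = 0) : N.pT.app X = X := by
  simpa [h] using N.pN_app_add_pT_app X

theorem pN_app_eq_self {X : VField I M} (h : N.pT.app X = 0) : N.pN.app X = X := by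
  simpa [h] using N.pN_app_add_pT_app X

/-- The vertical bundle is involutive. -/
def VerticalInvolutive : Prop :=
  ∀ U V : VField I M, U.Smooth → V.Smooth → N.pN.app U = 0 → N.pN.app V = 0 →
    N.pN.app (mlieBracket I U V) = 0

variable {N}

theorem torsionField_vertical_horizontal {U Z : VField I M} (hU : U.Smooth) (hZ : Z.Smooth)
    (hUv : N.pN.app U = 0) (hZh : N.pT.app Z = 0) :
    (N.canonicalConnection g).torsionField U Z = 0 := by
  rw [CovariantDerivative.torsionField_eq _ hU hZ, canonicalConnection_along N g hU,
    canonicalConnection_along N g hZ]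
  funext x
  have h := N.pN_add_pT x (mlieBracket I U Z x)
  simp only [Pi.sub_apply, canonicalFormula, hUv, hZh, N.pT_app_eq_self hUv,
    N.pN_app_eq_self hZh, mlieBracket_swap (V := Z) (W := U)]
  have h1 : N.pN x (U x) = 0 := congrFun hUv x
  have h2 : N.pT x (Z x) = 0 := congrFun hZh x
  simp only [h1, h2, Pi.neg_apply, map_neg, map_zero, mlieBracket_zero_right,
    Pi.zero_apply, CovariantDerivative.zero, zero_apply]
  linear_combination (norm := module) h

theorem torsionField_vertical_vertical (hN : N.VerticalInvolutive) {U V : VField I M}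
    (hU : U.Smooth) (hV : V.Smooth) (hUv : N.pN.app U = 0) (hVv : N.pN.app V = 0) :
    (N.canonicalConnection g).torsionField U V = 0 := by
  rw [CovariantDerivative.torsionField_eq _ hU hV, canonicalConnection_along N g hU,
    canonicalConnection_along N g hV]
  funext x
  have h := N.pN_add_pT x (mlieBracket I U V x)
  have h0 : N.pN x (mlieBracket I U V x) = 0 := congrFun (hN U V hU hV hUv hVv) x
  have hL := (N.canonicalExtension g).leviCivita_sub (hU.mdiff x) (hV.mdiff x)
  have h1 : N.pT x (U x) = U x := congrFun (N.pT_app_eq_self hUv) x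
  have h2 : N.pT x (V x) = V x := congrFun (N.pT_app_eq_self hVv) x
  simp only [Pi.sub_apply, canonicalFormula, hUv, hVv, N.pT_app_eq_self hUv,
    N.pT_app_eq_self hVv, h1, h2, map_zero, mlieBracket_zero_left,
    mlieBracket_zero_right, Pi.zero_apply, add_zero, CovariantDerivative.zero, zero_add,
    zero_apply]
  rw [← map_sub, hL, ← h, h0]
  simp [pT_pT]

theorem torsionField_vertical_left (hN : N.VerticalInvolutive) {U W : VField I M}
    (hU : U.Smooth) (hW : W.Smooth) (hUv : N.pN.app U = 0) :
    (N.canonicalConnection g).torsionField U W = 0 := by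
  rw [← N.pN_app_add_pT_app W, CovariantDerivative.torsionField_add_right,
    torsionField_vertical_horizontal g hU (N.pN_smooth.app hW) hUv
      (funext fun x ↦ N.pT_pN x _),
    torsionField_vertical_vertical g hN hU (N.pT_app_smooth hW) hUv
      (funext fun x ↦ N.pN_pT x _), add_zero]

theorem torsionField_vertical_right (hN : N.VerticalInvolutive) {U W : VField I M}
    (hU : U.Smooth) (hW : W.Smooth) (hUv : N.pN.app U = 0) :
    (N.canonicalConnection g).torsionField W U = 0 := by
  rw [CovariantDerivative.torsionField_swap, torsionField_vertical_left g hN hU hW hUv, neg_zero]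

/-- The torsion of the canonical connection takes vertical values. -/
theorem pN_torsionField (hN : N.VerticalInvolutive) {X Y : VField I M} (hX : X.Smooth)
    (hY : Y.Smooth) : N.pN.app ((N.canonicalConnection g).torsionField X Y) = 0 := by
  have hXN := N.pN_smooth.app hX
  have hYN := N.pN_smooth.app hY
  have hX0 : N.pT.app (N.pN.app X) = 0 := funext fun x ↦ N.pT_pN x _
  have hY0 : N.pT.app (N.pN.app Y) = 0 := funext fun x ↦ N.pT_pN x _
  have h : (N.canonicalConnection g).torsionField X Y =
      (N.canonicalConnection g).torsionField (N.pN.app X) (N.pN.app Y) := by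
    conv_lhs => rw [← N.pN_app_add_pT_app X, CovariantDerivative.torsionField_add_left,
      torsionField_vertical_left g hN (N.pT_app_smooth hX) hY (funext fun x ↦ N.pN_pT x _),
      add_zero, ← N.pN_app_add_pT_app Y, CovariantDerivative.torsionField_add_right,
      torsionField_vertical_right g hN (N.pT_app_smooth hY) hXN (funext fun x ↦ N.pN_pT x _),
      add_zero]
  rw [h, CovariantDerivative.torsionField_eq _ hXN hYN, canonicalConnection_along N g hXN,
    canonicalConnection_along N g hYN]
  funext x
  have hL := (N.canonicalExtension g).leviCivita_sub (hXN.mdiff x) (hYN.mdiff x)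
  have h1 : N.pN x (N.pN.app X x) = N.pN.app X x := N.pN_pN x _
  have h2 : N.pN x (N.pN.app Y x) = N.pN.app Y x := N.pN_pN x _
  change N.pN x (N.canonicalFormula g (N.pN.app X) (N.pN.app Y) x -
    N.canonicalFormula g (N.pN.app Y) (N.pN.app X) x -
    mlieBracket I (N.pN.app X) (N.pN.app Y) x) = 0
  simp only [canonicalFormula, hX0, hY0, N.pN_app_eq_self hX0,
    N.pN_app_eq_self hY0, h1, h2, mlieBracket_zero_left, mlieBracket_zero_right, ← hL]
  simp [EndField.app, pN_pN]

theorem torsionField_torsionField (hN : N.VerticalInvolutive) {X Y Z : VField I M}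
    (hX : X.Smooth) (hY : Y.Smooth) (hZ : Z.Smooth) :
    (N.canonicalConnection g).torsionField ((N.canonicalConnection g).torsionField X Y) Z = 0 :=
  torsionField_vertical_left g hN
    ((N.canonicalConnection_preservesSmooth g).torsionField hX hY) hZ (pN_torsionField g hN hX hY)

theorem pN_derivTorsion (hN : N.VerticalInvolutive) {X Y Z : VField I M}
    (hX : X.Smooth) (hY : Y.Smooth) (hZ : Z.Smooth) :
    N.pN.app ((N.canonicalConnection g).derivTorsion X Y Z) = 0 := by
  have hD := N.canonicalConnection_preservesSmooth g
  have h1 := pN_torsionField g hN (hD X Y hX hY) hZ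
  have h2 := pN_torsionField g hN hY (hD X Z hX hZ)
  funext x
  have h1 := congrFun h1 x
  have h2 := congrFun h2 x
  have h3 := N.pN_canonicalConnection g (pN_torsionField g hN hY hZ) x (X x)
  simp only [EndField.app] at h1 h2
  simp [EndField.app, CovariantDerivative.derivTorsion, h1, h2, h3]

theorem derivTorsion_vertical_left (hN : N.VerticalInvolutive) {X U W : VField I M}
    (hX : X.Smooth) (hU : U.Smooth) (hW : W.Smooth) (hUv : N.pN.app U = 0) :
    (N.canonicalConnection g).derivTorsion X U W = 0 := by
  have hD := N.canonicalConnection_preservesSmooth g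
  rw [CovariantDerivative.derivTorsion, torsionField_vertical_left g hN hU hW hUv,
    torsionField_vertical_left g hN (hD X U hX hU) hW
      (funext fun x ↦ N.pN_canonicalConnection g hUv x _),
    torsionField_vertical_left g hN hU (hD X W hX hW) hUv]
  funext x
  simp [CovariantDerivative.along]

theorem derivTorsion_vertical_right (hN : N.VerticalInvolutive) {X U W : VField I M}
    (hX : X.Smooth) (hU : U.Smooth) (hW : W.Smooth) (hUv : N.pN.app U = 0) :
    (N.canonicalConnection g).derivTorsion X W U = 0 := by
  have hD := N.canonicalConnection_preservesSmooth g
  rw [CovariantDerivative.derivTorsion, torsionField_vertical_right g hN hU hW hUv,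
    torsionField_vertical_right g hN (hD X U hX hU) hW
      (funext fun x ↦ N.pN_canonicalConnection g hUv x _),
    torsionField_vertical_right g hN hU (hD X W hX hW) hUv]
  funext x
  simp [CovariantDerivative.along]

/-- The first Bianchi identity of the canonical connection involves only the covariant derivative
of the torsion, as the vertical vectors are in the kernel of the torsion. -/
theorem cyclicSum_curvature (hN : N.VerticalInvolutive)
    (h : FirstBianchiIdentity (N.canonicalConnection g)) {X Y Z : VField I M}
    (hX : X.Smooth) (hY : Y.Smooth) (hZ : Z.Smooth) :
    cyclicSum (N.canonicalConnection g).curvature X Y Z =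
      cyclicSum (N.canonicalConnection g).derivTorsion X Y Z := by
  rw [h X Y Z hX hY hZ]
  simp only [cyclicSum, torsionField_torsionField g hN hX hY hZ,
    torsionField_torsionField g hN hY hZ hX, torsionField_torsionField g hN hZ hX hY, zero_add]

theorem cyclicSum_curvature_vertical (hN : N.VerticalInvolutive)
    (h : FirstBianchiIdentity (N.canonicalConnection g)) {U V W : VField I M}
    (hU : U.Smooth) (hV : V.Smooth) (hW : W.Smooth) (hUv : N.pN.app U = 0)
    (hVv : N.pN.app V = 0) (hWv : N.pN.app W = 0) :
    cyclicSum (N.canonicalConnection g).curvature U V W = 0 := by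
  rw [cyclicSum_curvature g hN h hU hV hW, cyclicSum,
    derivTorsion_vertical_left g hN hU hV hW hVv, derivTorsion_vertical_left g hN hV hW hU hWv,
    derivTorsion_vertical_left g hN hW hU hV hUv, add_zero, add_zero]

theorem curvature_vertical_horizontal_comm (hN : N.VerticalInvolutive)
    (h : FirstBianchiIdentity (N.canonicalConnection g)) {U V Z : VField I M}
    (hU : U.Smooth) (hV : V.Smooth) (hZ : Z.Smooth) (hUv : N.pN.app U = 0)
    (hVv : N.pN.app V = 0) (hZh : N.pT.app Z = 0) :
    (N.canonicalConnection g).curvature U Z V = (N.canonicalConnection g).curvature V Z U := by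
  have hB := cyclicSum_curvature g hN h hU hV hZ
  rw [cyclicSum, cyclicSum, derivTorsion_vertical_left g hN hU hV hZ hVv,
    derivTorsion_vertical_right g hN hV hU hZ hUv, derivTorsion_vertical_left g hN hZ hU hV hUv,
    add_zero, add_zero, CovariantDerivative.curvature_swap _ Z U] at hB
  have hT := congrArg N.pT.app hB
  simp only [app_add] at hT
  rw [N.pT_curvature g U V hZh, N.pT_app_eq_self (N.pN_curvature g V Z hUv), zero_add,
    N.pT_app_eq_self (X := -(N.canonicalConnection g).curvature U Z V)] at hT
  · have h0 : N.pT.app (0 : VField I M) = 0 := funext fun x ↦ map_zero _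
    rw [h0, ← sub_eq_add_neg, sub_eq_zero] at hT
    exact hT.symm
  · rw [← CovariantDerivative.curvature_swap]
    exact N.pN_curvature g Z U hVv

theorem cyclicSum_curvature_horizontal (hN : N.VerticalInvolutive)
    (h : FirstBianchiIdentity (N.canonicalConnection g)) {X Y Z : VField I M}
    (hX : X.Smooth) (hY : Y.Smooth) (hZ : Z.Smooth) (hXh : N.pT.app X = 0)
    (hYh : N.pT.app Y = 0) (hZh : N.pT.app Z = 0) :
    cyclicSum (N.canonicalConnection g).curvature X Y Z = 0 := by
  have hT : N.pT.app (cyclicSum (N.canonicalConnection g).curvature X Y Z) = 0 := by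
    rw [cyclicSum, app_add, app_add, N.pT_curvature g X Y hZh, N.pT_curvature g Y Z hXh,
      N.pT_curvature g Z X hYh, add_zero, add_zero]
  have hv : N.pN.app (cyclicSum (N.canonicalConnection g).curvature X Y Z) = 0 := by
    rw [cyclicSum_curvature g hN h hX hY hZ, cyclicSum, app_add, app_add,
      pN_derivTorsion g hN hX hY hZ, pN_derivTorsion g hN hY hZ hX,
      pN_derivTorsion g hN hZ hX hY, add_zero, add_zero]
  rw [← N.pN_app_add_pT_app (cyclicSum _ X Y Z), hT, hv, add_zero]

end Normalization

end CanonicalConnection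

section Involutivity

variable {n : ℕ} {M : Type*} [TopologicalSpace M] [ChartedSpace (TangentModel n) M]
  [IsManifold 𝓘(ℝ, TangentModel n) ∞ M]

/-- The Lie bracket of two vector fields tangent to the second factor of a product, near a point,
is tangent to it at this point. -/
theorem lieBracket_fst_eq_zero {F G : Type*} [NormedAddCommGroup F] [NormedSpace ℝ F]
    [NormedAddCommGroup G] [NormedSpace ℝ G] {U V : F × G → F × G} {y : F × G}
    (hU : ∀ᶠ z in 𝓝 y, (U z).1 = 0) (hV : ∀ᶠ z in 𝓝 y, (V z).1 = 0) :
    (lieBracket ℝ U V y).1 = 0 := by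
  have key {U : F × G → F × G} (hU : ∀ᶠ z in 𝓝 y, (U z).1 = 0) (v : F × G) :
      (fderiv ℝ U y v).1 = 0 := by
    by_cases h : DifferentiableAt ℝ U y
    · have h0 : (fun z ↦ (U z).1) =ᶠ[𝓝 y] fun _ ↦ 0 := hU
      have h1 := h0.fderiv_eq (𝕜 := ℝ)
      rw [fderiv.fst h] at h1
      simpa using congrArg (fun f : F × G →L[ℝ] F ↦ f v) h1
    · simp [fderiv_zero_of_not_differentiableAt h]
  simp [lieBracket, key hU, key hV]

theorem mlieBracket_eq_lieBracket {F : Type*} [NormedAddCommGroup F] [NormedSpace ℝ F]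
    (U V : VField 𝓘(ℝ, F) F) (y : F) : mlieBracket 𝓘(ℝ, F) U V y = lieBracket ℝ U V y := by
  rw [← mlieBracketWithin_univ, mlieBracketWithin_eq_lieBracketWithin]
  exact congrFun lieBracketWithin_univ y

theorem AlmostTangentStructure.IsIntegrable.verticalInvolutive
    {𝒮 : AlmostTangentStructure 𝓘(ℝ, TangentModel n) M} (h𝒮 : 𝒮.IsIntegrable)
    (N : Normalization 𝒮) : N.VerticalInvolutive := by
  intro U V hU hV hUv hVv
  funext p
  obtain ⟨e, he, hp, heS⟩ := h𝒮 p
  have hed : e.MDifferentiable 𝓘(ℝ, TangentModel n) 𝓘(ℝ, TangentModel n) :=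
    ⟨(contMDiffOn_of_mem_maximalAtlas he).mdifferentiableOn (by simp),
      (contMDiffOn_symm_of_mem_maximalAtlas he).mdifferentiableOn (by simp)⟩
  have hinv (y : TangentModel n) (hy : y ∈ e.target) :
      (mfderiv 𝓘(ℝ, TangentModel n) 𝓘(ℝ, TangentModel n) e.symm y).inverse =
        mfderiv 𝓘(ℝ, TangentModel n) 𝓘(ℝ, TangentModel n) e (e.symm y) := by
    refine ContinuousLinearMap.inverse_eq (hed.symm_comp_deriv (e.map_target hy) ▸ ?_)
      (hed.comp_symm_deriv hy)
    rw [e.right_inv hy]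
  have hpull (W : VField 𝓘(ℝ, TangentModel n) M) (y : TangentModel n) (hy : y ∈ e.target) :
      mpullback 𝓘(ℝ, TangentModel n) 𝓘(ℝ, TangentModel n) e.symm W y =
        mvfderiv 𝓘(ℝ, TangentModel n) e (e.symm y) (W (e.symm y)) := by
    rw [mpullback_apply, hinv y hy]
    rfl
  have hS {W : VField 𝓘(ℝ, TangentModel n) M} {x : M} (hx : x ∈ e.source)
      (hW : N.pN x (W x) = 0) : (mvfderiv 𝓘(ℝ, TangentModel n) e x (W x)).1 = 0 := by
    have : W x = 𝒮.S x (N.Sinv x (W x)) := by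
      rw [N.S_Sinv, ← N.pN_add_pT x (W x), hW, zero_add, N.pT_pT]
    rw [this, heS x hx]
  have hev {W : VField 𝓘(ℝ, TangentModel n) M} (hW : N.pN.app W = 0) :
      ∀ᶠ y in 𝓝 (e p), (mpullback 𝓘(ℝ, TangentModel n) 𝓘(ℝ, TangentModel n) e.symm W y).1 = 0 := by
    filter_upwards [e.open_target.mem_nhds (e.map_source hp)] with y hy
    rw [hpull W y hy]
    exact hS (e.map_target hy) (congrFun hW _)
  have : IsManifold 𝓘(ℝ, TangentModel n) (minSmoothness ℝ 2) M := by
    rw [minSmoothness_of_isRCLikeNormedField]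
    infer_instance
  have hb := mpullback_mlieBracket (n := ∞) (I := 𝓘(ℝ, TangentModel n)) (f := e.symm) (x₀ := e p)
    (by rw [e.left_inv hp]; exact hU.mdiff p) (by rw [e.left_inv hp]; exact hV.mdiff p)
    ((contMDiffOn_symm_of_mem_maximalAtlas he).contMDiffAt
      (e.open_target.mem_nhds (e.map_source hp)))
    (by rw [minSmoothness_of_isRCLikeNormedField]; exact WithTop.coe_le_coe.2 le_top)
  rw [hpull _ _ (e.map_source hp), e.left_inv hp] at hb
  replace hb := hb.trans (mlieBracket_eq_lieBracket _ _ _)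
  have h1 := lieBracket_fst_eq_zero (hev hUv) (hev hVv)
  have h2 : mvfderiv 𝓘(ℝ, TangentModel n) e p (𝒮.S p (mlieBracket 𝓘(ℝ, TangentModel n) U V p)) =
      0 := by
    rw [heS p hp, hb, h1]
    rfl
  have h3 : 𝒮.S p (mlieBracket 𝓘(ℝ, TangentModel n) U V p) = 0 :=
    (hed.mfderiv hp).injective (h2.trans (map_zero (hed.mfderiv hp)).symm)
  simpa using! N.eq_of_S_eq (h3.trans (map_zero (𝒮.S p)).symm)

end Involutivity

theorem proposition3p4 {n : ℕ} {M : Type*} [TopologicalSpace M] [T2Space M]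
    [SecondCountableTopology M] [ChartedSpace (TangentModel n) M]
    [IsManifold 𝓘(ℝ, TangentModel n) ∞ M]
    (𝒮 : AlmostTangentStructure 𝓘(ℝ, TangentModel n) M) (h𝒮 : 𝒮.IsIntegrable)
    (N : Normalization 𝒮) (g : TransversalMetric 𝒮) :
    FirstBianchiIdentity (N.canonicalConnection g) ∧
    (FirstBianchiIdentity (N.canonicalConnection g) ↔
      (∀ X Y Z, N.IsHorizontal X → N.IsHorizontal Y → N.IsHorizontal Z →
        cyclicSum (fun X Y Z ↦ (N.canonicalConnection g).curvature
          (𝒮.S.app X) (𝒮.S.app Y) (𝒮.S.app Z)) X Y Z = 0) ∧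
      (∀ X Y Z, N.IsHorizontal X → N.IsHorizontal Y → N.IsHorizontal Z →
        (N.canonicalConnection g).curvature (𝒮.S.app X) Z (𝒮.S.app Y) =
          (N.canonicalConnection g).curvature (𝒮.S.app Y) Z (𝒮.S.app X)) ∧
      (∀ X Y Z, N.IsHorizontal X → N.IsHorizontal Y → N.IsHorizontal Z →
        cyclicSum (N.canonicalConnection g).curvature X Y Z = 0)) := by
  have hN := h𝒮.verticalInvolutive N
  have hB : FirstBianchiIdentity (N.canonicalConnection g) :=
    (N.canonicalConnection_preservesSmooth g).firstBianchiIdentity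
  have hS {X : VField 𝓘(ℝ, TangentModel n) M} (hX : N.IsHorizontal X) :
      VField.Smooth (𝒮.S.app X) ∧ N.pN.app (𝒮.S.app X) = 0 :=
    ⟨𝒮.smooth.app hX.1, funext fun x ↦ N.pN_S x _⟩
  have hT {X : VField 𝓘(ℝ, TangentModel n) M} (hX : N.IsHorizontal X) : N.pT.app X = 0 :=
    funext fun x ↦ by simp [EndField.app, Normalization.pT, N.pN_of_mem (hX.2 x)]
  refine ⟨hB, fun h ↦ ⟨fun X Y Z hX hY hZ ↦ ?_, fun X Y Z hX hY hZ ↦ ?_,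
    fun X Y Z hX hY hZ ↦ ?_⟩, fun _ ↦ hB⟩
  · exact Normalization.cyclicSum_curvature_vertical g hN h (hS hX).1 (hS hY).1 (hS hZ).1
      (hS hX).2 (hS hY).2 (hS hZ).2
  · exact Normalization.curvature_vertical_horizontal_comm g hN h (hS hX).1 (hS hY).1 hZ.1
      (hS hX).2 (hS hY).2 (hT hZ)
  · exact Normalization.cyclicSum_curvature_horizontal g hN h hX.1 hY.1 hZ.1
      (hT hX) (hT hY) (hT hZ)
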